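/- For an integer $n \ge 0$ let $[n]=\{1,2,\dots,n\}$, and let $P$ be a partition of the set $[n]$. An arc of $P$ is a pair $(i,j)$ with $i<j$ such that $i$ and $j$ lie in the same block of $P$ and no element $m$ of that block satisfies $i<m<j$. A $k$-crossing of $P$ is a set of $k$ arcs $(i_1,j_1),\dots,(i_k,j_k)$ of $P$ with $$i_1<i_2<\cdots<i_k<j_1<j_2<\cdots<j_k,$$ and a $k$-nesting of $P$ is a set of $k$ arcs $(i_1,j_1),\dots,(i_k,j_k)$ of $P$ with $$i_1<i_2<\cdots<i_k<j_k<\cdots<j_2<j_1.$$ Let $\mathrm{cr}(P)$ (respectively $\mathrm{ne}(P)$) be the maximal $k$ such that $P$ has a $k$-crossing (respectively a $k$-nesting); thus a single arc is both a $1$-crossing and a $1$-nesting, and $\mathrm{cr}(P)=\mathrm{ne}(P)=0$ if $P$ has no arcs. The partition $P$ is called $k$-noncrossing if $\mathrm{cr}(P)<k$, and $k$-nonnesting if $\mathrm{ne}(P)<k$. Let $\mathrm{NCN}_{k,l}(n)$ be the number of partitions of $[n]$ that are $k$-noncrossing and $l$-nonnesting. **Corollary 1.2.** For all integers $k,l,n\ge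 0$, $$\mathrm{NCN}_{k,l}(n)=\mathrm{NCN}_{l,k}(n).$$ -/

import Mathlib

/-- A partition of the set `[n] = {1, 2, …, n}`. -/
abbrev SetPartition (n : ℕ) : Type := Finpartition (Finset.Icc 1 n)

namespace SetPartition

variable {n : ℕ}

/-- `(i, j)` is an arc of the standard representation of `P`: `i < j` are numerically consecutive
elements of one block of `P`. -/
def IsArc (P : SetPartition n) (i j : ℕ) : Prop :=
  i < j ∧ ∃ B ∈ P.parts, i ∈ B ∧ j ∈ B ∧ ∀ m ∈ B, ¬ (i < m ∧ m < j)

/-- `P` has a `k`-crossing: `k` arcs `(i₁, j₁), …, (iₖ, jₖ)` such that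
`i₁ < i₂ < ⋯ < iₖ < j₁ < j₂ < ⋯ < jₖ`. -/
def HasCrossing (P : SetPartition n) (k : ℕ) : Prop :=
  ∃ i j : Fin k → ℕ, (∀ r, P.IsArc (i r) (j r)) ∧
    StrictMono i ∧ StrictMono j ∧ ∀ r s, i r < j s

/-- `P` has a `k`-nesting: `k` arcs `(i₁, j₁), …, (iₖ, jₖ)` such that
`i₁ < i₂ < ⋯ < iₖ < jₖ < ⋯ < j₂ < j₁`. -/
def HasNesting (P : SetPartition n) (k : ℕ) : Prop :=
  ∃ i j : Fin k → ℕ, (∀ r, P.IsArc (i r) (j r)) ∧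
    StrictMono i ∧ StrictAnti j ∧ ∀ r s, i r < j s

/-- The crossing number: the maximal `k` such that `P` has a `k`-crossing. A single arc is a
`1`-crossing, and the crossing number is `0` when there are no arcs. -/
noncomputable def cr (P : SetPartition n) : ℕ := sSup {k | P.HasCrossing k}

/-- The nesting number: the maximal `k` such that `P` has a `k`-nesting. A single arc is a
`1`-nesting, and the nesting number is `0` when there are no arcs. -/
noncomputable def ne (P : SetPartition n) : ℕ := sSup {k | P.HasNesting k}

theorem le_of_arcs (P : SetPartition n) {k : ℕ} {i j : Fin k → ℕ}
    (h : ∀ r, P.IsArc (i r) (j r)) (hi : StrictMono i) : k ≤ n := by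
  have hmem : ∀ r, i r ∈ Finset.Icc 1 n := fun r => by
    obtain ⟨-, B, hB, hiB, -⟩ := h r
    exact P.le hB hiB
  simpa using Finset.card_le_card_of_injOn (s := Finset.univ) (t := Finset.Icc 1 n) i
    (fun r _ => hmem r) hi.injective.injOn

/-- The maximum in the definition of the crossing number is attained. -/
theorem isGreatest_cr (P : SetPartition n) : IsGreatest {k | P.HasCrossing k} P.cr := by
  have hb : BddAbove {k | P.HasCrossing k} :=
    ⟨n, fun _ ⟨_, _, h, hi, _⟩ => P.le_of_arcs h hi⟩
  have h0 : P.HasCrossing 0 :=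
    ⟨Fin.elim0, Fin.elim0, fun r => r.elim0, fun r => r.elim0, fun r => r.elim0, fun r => r.elim0⟩
  exact ⟨Nat.sSup_mem ⟨0, h0⟩ hb, fun _ hk => le_csSup hb hk⟩

/-- The maximum in the definition of the nesting number is attained. -/
theorem isGreatest_ne (P : SetPartition n) : IsGreatest {k | P.HasNesting k} P.ne := by
  have hb : BddAbove {k | P.HasNesting k} :=
    ⟨n, fun _ ⟨_, _, h, hi, _⟩ => P.le_of_arcs h hi⟩
  have h0 : P.HasNesting 0 :=
    ⟨Fin.elim0, Fin.elim0, fun r => r.elim0, fun r => r.elim0, fun r => r.elim0, fun r => r.elim0⟩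
  exact ⟨Nat.sSup_mem ⟨0, h0⟩ hb, fun _ hk => le_csSup hb hk⟩

/-- `P` is `k`-noncrossing if its crossing number is less than `k`. -/
def IsNoncrossing (P : SetPartition n) (k : ℕ) : Prop := P.cr < k

/-- `P` is `k`-nonnesting if its nesting number is less than `k`. -/
def IsNonnesting (P : SetPartition n) (k : ℕ) : Prop := P.ne < k

end SetPartition

open Classical in
/-- The number of partitions of `[n]` that are `k`-noncrossing and `l`-nonnesting. -/
noncomputable def NCN (k l n : ℕ) : ℕ :=
  (Finset.univ.filter fun P : SetPartition n => P.IsNoncrossing k ∧ P.IsNonnesting l).card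

/-! Draw each arc (i, j) as the cell (i - 1, n - j) of a staircase. Set partitions of [n] become the
placements in the staircase with at most one cell per row and column. Nestings become increasing
chains and crossings become decreasing chains. The arcs of one crossing or nesting all span a common
gap, so the chain lies in a rectangle [0, t) × [0, n - t) with its corner on the boundary of the
staircase.

Label each lattice point with the Robinson–Schensted shape of the rectangle below it, built from
Viennot's iterated shadows. Its first row is the longest increasing chain. Its number of rows is the
longest decreasing chain (`decChain_iff`), because passing to the shadow shortens decreasing chains
by one (`IsPlacement.decChain_shadow_iff`).

Neighbouring labels differ by at most one box, and Fomin's local rule can be run backwards. Hence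
the boundary labels determine the placement (`eq_of_shape_eq`), and every admissible boundary
sequence occurs (`IsBoundary.exists_placement`). Conjugation preserves admissibility, so conjugating
all boundary labels is an involution on set partitions that exchanges crossing and nesting numbers.
-/

/-- A set of cells of `ℕ × ℕ` with at most one cell in each row and each column. -/
structure IsPlacement (X : ℕ → ℕ → Prop) : Prop where
  snd_unique : ∀ {x y y'}, X x y → X x y' → y = y'
  fst_unique : ∀ {x x' y}, X x y → X x' y → x = x'

open Classical in
/-- The length of the longest increasing chain of cells of `X` in `[0, x) × [0, y)`, for a
placement `X`. -/
noncomputable def lis (X : ℕ → ℕ → Prop) : ℕ → ℕ → ℕ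
  | 0, _ => 0
  | _ + 1, 0 => 0
  | x + 1, y + 1 => if X x y then lis X x y + 1 else max (lis X (x + 1) y) (lis X x (y + 1))
termination_by x y => x + y

/-- The inner corners of Viennot's shadow lines of `X`. -/
def shadow (X : ℕ → ℕ → Prop) (x y : ℕ) : Prop :=
  lis X (x + 1) y = lis X x y + 1 ∧ lis X x (y + 1) = lis X x y + 1

/-- The iterated shadows of `X`. -/
def skel (X : ℕ → ℕ → Prop) : ℕ → ℕ → ℕ → Prop
  | 0 => X
  | r + 1 => shadow (skel X r)

/-- The Robinson–Schensted shape of the part of `X` in `[0, x) × [0, y)`. -/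
noncomputable def shape (X : ℕ → ℕ → Prop) (x y r : ℕ) : ℕ := lis (skel X r) x y

/-! ### Growth of longest chains and Viennot's shadows -/

section lis

variable {X : ℕ → ℕ → Prop}

@[simp] theorem lis_zero_left (y : ℕ) : lis X 0 y = 0 := by rw [lis]

@[simp] theorem lis_zero_right (x : ℕ) : lis X x 0 = 0 := by cases x <;> rw [lis]

theorem lis_succ_of_mem {x y : ℕ} (h : X x y) : lis X (x + 1) (y + 1) = lis X x y + 1 := by
  rw [lis, if_pos h]

theorem lis_succ_of_notMem {x y : ℕ} (h : ¬ X x y) :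
    lis X (x + 1) (y + 1) = max (lis X (x + 1) y) (lis X x (y + 1)) := by
  rw [lis, if_neg h]

theorem lis_swap (X : ℕ → ℕ → Prop) (x y : ℕ) : lis (fun a b => X b a) x y = lis X y x := by
  induction h : x + y using Nat.strong_induction_on generalizing x y with
  | _ s ih =>
    subst h
    rcases x with _ | x
    · simp
    rcases y with _ | y
    · simp
    by_cases hX : X y x
    · rw [lis_succ_of_mem (X := fun a b => X b a) hX, lis_succ_of_mem hX,
        ih (x + y) (by omega) x y rfl]
    · rw [lis_succ_of_notMem (X := fun a b => X b a) hX, lis_succ_of_notMem hX,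
        ih (x + 1 + y) (by omega) (x + 1) y rfl, ih (x + (y + 1)) (by omega) x (y + 1) rfl, max_comm]

theorem shadow_swap (X : ℕ → ℕ → Prop) (x y : ℕ) :
    shadow (fun a b => X b a) x y ↔ shadow X y x := by
  simp only [shadow, lis_swap, and_comm]

namespace IsPlacement

theorem swap (h : IsPlacement X) : IsPlacement fun a b => X b a :=
  ⟨fun h₁ h₂ => h.fst_unique h₁ h₂, fun h₁ h₂ => h.snd_unique h₁ h₂⟩

/-- The placement is quantified inside the induction so that the hypothesis also applies to the
transpose, which controls the other edge of the unit square. -/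
theorem lis_succ_left_aux (s : ℕ) : ∀ X : ℕ → ℕ → Prop, IsPlacement X → ∀ x y, x + y = s →
    (lis X (x + 1) y = lis X x y ∨ lis X (x + 1) y = lis X x y + 1) ∧
      ((∀ v < y, ¬ X x v) → lis X (x + 1) y = lis X x y) := by
  induction s with
  | zero =>
    intro X _ x y hs
    obtain rfl : y = 0 := by omega
    simp
  | succ s ih =>
    intro X h x y hs
    rcases y with _ | y
    · simp
    obtain ⟨h₁, h₂⟩ := ih X h x y (by omega)
    obtain ⟨h₃, h₄⟩ := ih _ h.swap y x (by omega)
    simp only [lis_swap] at h₃ h₄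
    by_cases hX : X x y
    · have := lis_succ_of_mem hX
      have := h₄ fun v hv hv' => hv.ne (h.fst_unique hv' hX)
      exact ⟨by omega, fun h' => absurd hX (h' y (by omega))⟩
    · have := lis_succ_of_notMem hX
      refine ⟨by omega, fun h' => ?_⟩
      have := h₂ fun v hv => h' v (by omega)
      omega

theorem lis_succ_left (h : IsPlacement X) (x y : ℕ) :
    lis X (x + 1) y = lis X x y ∨ lis X (x + 1) y = lis X x y + 1 :=
  (lis_succ_left_aux _ X h x y rfl).1

theorem lis_succ_left_of_empty (h : IsPlacement X) {x y : ℕ} (hX : ∀ v < y, ¬ X x v) :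
    lis X (x + 1) y = lis X x y :=
  (lis_succ_left_aux _ X h x y rfl).2 hX

theorem lis_succ_right (h : IsPlacement X) (x y : ℕ) :
    lis X x (y + 1) = lis X x y ∨ lis X x (y + 1) = lis X x y + 1 := by
  simpa only [lis_swap] using h.swap.lis_succ_left y x

theorem lis_succ_right_of_empty (h : IsPlacement X) {x y : ℕ} (hX : ∀ u < x, ¬ X u y) :
    lis X x (y + 1) = lis X x y := by
  simpa only [lis_swap] using h.swap.lis_succ_left_of_empty hX

theorem lis_left_of_mem (h : IsPlacement X) {x y : ℕ} (hX : X x y) :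
    lis X (x + 1) y = lis X x y :=
  h.lis_succ_left_of_empty fun _ hv hv' => hv.ne (h.snd_unique hv' hX)

theorem lis_right_of_mem (h : IsPlacement X) {x y : ℕ} (hX : X x y) :
    lis X x (y + 1) = lis X x y :=
  h.lis_succ_right_of_empty fun _ hv hv' => hv.ne (h.fst_unique hv' hX)

/-- The trichotomy for the part of the column `x` below height `y`: it has no cell, or `lis`
grows across it and it has no shadow cell, or `lis` does not grow across it and it has a shadow
cell. -/
theorem column_trichotomy (h : IsPlacement X) (x y : ℕ) :
    ((∀ v < y, ¬ X x v) ∧ lis X (x + 1) y = lis X x y ∧ ∀ v < y, ¬ shadow X x v) ∨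
      ((∃ v < y, X x v) ∧ lis X (x + 1) y = lis X x y + 1 ∧ ∀ v < y, ¬ shadow X x v) ∨
      ((∃ v < y, X x v) ∧ lis X (x + 1) y = lis X x y ∧ ∃ v < y, shadow X x v) := by
  induction y with
  | zero => simp
  | succ y ih =>
    have hr := h.lis_succ_right x y
    simp only [Nat.forall_lt_succ_right, Nat.exists_lt_succ_right]
    by_cases hX : X x y
    · have h₁ := lis_succ_of_mem hX
      have h₂ := h.lis_left_of_mem hX
      have h₃ := h.lis_right_of_mem hX
      have h₄ : ¬ shadow X x y := fun h' => by have := h'.1; omega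
      have h₅ : ¬ ∃ v < y, X x v := fun ⟨v, hv, hv'⟩ => hv.ne (h.snd_unique hv' hX)
      rcases ih with ih | ih | ih
      · exact Or.inr (Or.inl ⟨Or.inr hX, by omega, ih.2.2, h₄⟩)
      · exact absurd ih.1 h₅
      · exact absurd ih.1 h₅
    · have h₁ := lis_succ_of_notMem hX
      rcases ih with ih | ih | ih
      · have h₄ : ¬ shadow X x y := fun h' => by have := h'.1; omega
        exact Or.inl ⟨⟨ih.1, hX⟩, by omega, ih.2.2, h₄⟩
      -- If `lis` also rises along the left side here, the left side catches up with the right one;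
      -- this height is the shadow cell.
      · rcases hr with hr | hr
        · have h₄ : ¬ shadow X x y := fun h' => by have := h'.2; omega
          exact Or.inr (Or.inl ⟨Or.inl ih.1, by omega, ih.2.2, h₄⟩)
        · exact Or.inr (Or.inr ⟨Or.inl ih.1, by omega, Or.inr ⟨ih.2.1, hr⟩⟩)
      · exact Or.inr (Or.inr ⟨Or.inl ih.1, by omega, Or.inl ih.2.2⟩)

theorem exists_lt_of_shadow (h : IsPlacement X) {x y : ℕ} (hs : shadow X x y) :
    ∃ v < y, X x v := by
  have := hs.1
  rcases h.column_trichotomy x y with h' | h' | h'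
  · omega
  · exact h'.1
  · exact h'.1

theorem not_shadow_of_lt (h : IsPlacement X) {x y v : ℕ} (hs : shadow X x y) (hv : v < y) :
    ¬ shadow X x v := by
  have := hs.1
  rcases h.column_trichotomy x y with h' | h' | h'
  · omega
  · exact h'.2.2 v hv
  · omega

theorem lis_left_of_lt (h : IsPlacement X) {x y v : ℕ} (hX : X x v) (hv : v < y)
    (hs : ∀ w < y, ¬ shadow X x w) : lis X (x + 1) y = lis X x y + 1 := by
  rcases h.column_trichotomy x y with h' | h' | ⟨-, -, w, hw, hw'⟩
  · exact absurd hX (h'.1 v hv)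
  · exact h'.2.1
  · exact absurd hw' (hs w hw)

theorem isPlacement_shadow (h : IsPlacement X) : IsPlacement (shadow X) where
  snd_unique {x y y'} h₁ h₂ := by
    rcases lt_trichotomy y y' with hy | hy | hy
    · exact absurd h₁ (h.not_shadow_of_lt h₂ hy)
    · exact hy
    · exact absurd h₂ (h.not_shadow_of_lt h₁ hy)
  fst_unique {x x' y} h₁ h₂ := by
    rw [← shadow_swap] at h₁ h₂
    rcases lt_trichotomy x x' with hx | hx | hx
    · exact absurd h₁ (h.swap.not_shadow_of_lt h₂ hx)
    · exact hx
    · exact absurd h₂ (h.swap.not_shadow_of_lt h₁ hx)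

theorem isPlacement_skel (h : IsPlacement X) (r : ℕ) : IsPlacement (skel X r) := by
  induction r with
  | zero => exact h
  | succ r ih => exact ih.isPlacement_shadow

end IsPlacement

/-! ### Shapes and their growth by at most one box -/

theorem skel_swap (X : ℕ → ℕ → Prop) (r : ℕ) :
    skel (fun a b => X b a) r = fun a b => skel X r b a := by
  induction r with
  | zero => rfl
  | succ r ih =>
    ext x y
    simp only [skel, ih]
    exact shadow_swap _ _ _

theorem shape_swap (X : ℕ → ℕ → Prop) (x y : ℕ) : shape (fun a b => X b a) x y = shape X y x := by
  ext r
  simp only [shape, skel_swap, lis_swap]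

/-- Each shadow cell lies strictly above a cell of the previous level in the same column. This makes
shapes finite. -/
theorem le_of_skel (h : IsPlacement X) {r x y : ℕ} (hs : skel X r x y) : r ≤ y := by
  induction r generalizing y with
  | zero => omega
  | succ r ih =>
    obtain ⟨v, hv, hv'⟩ := (h.isPlacement_skel r).exists_lt_of_shadow hs
    have := ih hv'
    omega

theorem lis_eq_zero {x y : ℕ} (hX : ∀ u v, v < y → ¬ X u v) : lis X x y = 0 := by
  induction h : x + y using Nat.strong_induction_on generalizing x y with
  | _ s ih =>
    subst h
    rcases x with _ | x
    · simp
    rcases y with _ | y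
    · simp
    rw [lis_succ_of_notMem (hX x y (by omega)), ih (x + 1 + y) (by omega) (fun u v hv => hX u v
      (by omega)) rfl, ih (x + (y + 1)) (by omega) hX rfl, max_self]

/-- At a shadow cell, where the left side gains one, `lis X` has already risen along an edge. This
makes the rows of a shape weakly decreasing. -/
theorem lis_shadow_le (h : IsPlacement X) (x y : ℕ) : lis (shadow X) x y ≤ lis X x y := by
  induction hs : x + y using Nat.strong_induction_on generalizing x y with
  | _ s ih =>
    subst hs
    rcases x with _ | x
    · simp
    rcases y with _ | y
    · simp
    have h₀ := ih (x + y) (by omega) x y rfl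
    have h₁ := ih (x + 1 + y) (by omega) (x + 1) y rfl
    have h₂ := ih (x + (y + 1)) (by omega) x (y + 1) rfl
    have h₃ := h.lis_succ_right (x + 1) y
    have h₄ := h.lis_succ_left x (y + 1)
    by_cases hX : shadow X x y
    · have := hX.1
      rw [lis_succ_of_mem hX]
      omega
    · rw [lis_succ_of_notMem hX]
      omega

/-- A partition of an integer, as its weakly decreasing sequence of parts. -/
structure IsShape (f : ℕ → ℕ) : Prop where
  antitone : Antitone f
  exists_eq_zero : ∃ i, f i = 0

/-- The shape `g` is equal to `f` or obtained from it by adding one box. -/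
structure Step (f g : ℕ → ℕ) : Prop where
  eq_or : ∀ r, g r = f r ∨ g r = f r + 1
  unique : ∀ {r s}, f r ≠ g r → f s ≠ g s → r = s

theorem isShape_shape (h : IsPlacement X) (x y : ℕ) : IsShape (shape X x y) where
  antitone := antitone_nat_of_succ_le fun r => lis_shadow_le (h.isPlacement_skel r) x y
  exists_eq_zero := ⟨y, lis_eq_zero fun u v hv hs => by
    have := le_of_skel h hs
    omega⟩

/-- If level r grows across the column, the trichotomy leaves no shadow cell in it at level r + 1.
An empty column casts no further shadows, so no later level grows. -/
theorem step_shape_left (h : IsPlacement X) (x y : ℕ) :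
    Step (shape X x y) (shape X (x + 1) y) where
  eq_or r := (h.isPlacement_skel r).lis_succ_left x y
  unique {r s} hr hs := by
    have key : ∀ r, shape X x y r ≠ shape X (x + 1) y r →
        ∀ k, ∀ v < y, ¬ skel X (r + 1 + k) x v := by
      intro r hr k
      induction k with
      | zero =>
        rcases (h.isPlacement_skel r).column_trichotomy x y with h' | h' | h'
        · exact absurd h'.2.1.symm hr
        · exact h'.2.2
        · exact absurd h'.2.1.symm hr
      | succ k ih =>
        intro v hv hs
        obtain ⟨w, hw, hw'⟩ := (h.isPlacement_skel (r + 1 + k)).exists_lt_of_shadow hs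
        exact ih w (by omega) hw'
    have key' : ∀ r s, r < s → shape X x y r ≠ shape X (x + 1) y r →
        shape X x y s = shape X (x + 1) y s := by
      intro r s hrs hr
      obtain ⟨k, rfl⟩ := Nat.exists_eq_add_of_lt hrs
      refine ((h.isPlacement_skel _).lis_succ_left_of_empty ?_).symm
      have := key r hr k
      rwa [show r + 1 + k = r + k + 1 by omega] at this
    rcases lt_trichotomy r s with hrs | hrs | hrs
    · exact absurd (key' r s hrs hr) hs
    · exact hrs
    · exact absurd (key' s r hrs hs) hr

theorem step_shape_right (h : IsPlacement X) (x y : ℕ) :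
    Step (shape X x y) (shape X x (y + 1)) := by
  simpa only [shape_swap] using step_shape_left h.swap y x

@[simp] theorem shape_zero_left (y : ℕ) : shape X 0 y = 0 := by ext; simp [shape]

@[simp] theorem shape_zero_right (x : ℕ) : shape X x 0 = 0 := by ext; simp [shape]

open Classical in
/-- The inverse local rule: the south-west label of a cell, given the other three labels. -/
noncomputable def back (b c d : ℕ → ℕ) (r : ℕ) : ℕ :=
  min (b r) (c r) - if max (b (r + 1)) (c (r + 1)) < d (r + 1) then 1 else 0

theorem skel_iff (h : IsPlacement X) (x y r : ℕ) : skel X r x y ↔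
    max (shape X (x + 1) y r) (shape X x (y + 1) r) < shape X (x + 1) (y + 1) r := by
  have hr := h.isPlacement_skel r
  unfold shape
  by_cases hX : skel X r x y
  · have := lis_succ_of_mem hX
    have := hr.lis_left_of_mem hX
    have := hr.lis_right_of_mem hX
    simp only [hX, true_iff]
    omega
  · have := lis_succ_of_notMem hX
    simp only [hX, false_iff]
    omega

/-- A cell of level r + 1 sits at (x, y) exactly when level r rises along both edges leaving (x, y).
Then row r is one less than both neighbours; otherwise it equals the smaller one. By `skel_iff`, the
labels show which case occurs. -/
theorem shape_eq_back (h : IsPlacement X) (x y : ℕ) :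
    shape X x y = back (shape X (x + 1) y) (shape X x (y + 1)) (shape X (x + 1) (y + 1)) := by
  ext r
  unfold back
  have h₀ := skel_iff h x y (r + 1)
  have h₁ := (h.isPlacement_skel r).lis_succ_left x y
  have h₂ := (h.isPlacement_skel r).lis_succ_right x y
  change shadow (skel X r) x y ↔ _ at h₀
  unfold shadow at h₀
  unfold shape at h₀ ⊢
  split_ifs with hs
  · have := h₀.2 hs
    omega
  · have := mt h₀.1 hs
    omega

/-- A placement in a staircase is determined by its shapes along the boundary. -/
theorem eq_of_shape_eq {X' : ℕ → ℕ → Prop} (h : IsPlacement X) (h' : IsPlacement X') {n : ℕ}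
    (hX : ∀ x y, X x y → x + y + 1 < n) (hX' : ∀ x y, X' x y → x + y + 1 < n)
    (hs : ∀ x y, x + y ≤ n → n ≤ x + y + 1 → shape X x y = shape X' x y) : X = X' := by
  have key : ∀ k x y, x + y ≤ n → n ≤ x + y + k → shape X x y = shape X' x y := by
    intro k
    induction k with
    | zero => exact fun x y h₁ h₂ => hs x y h₁ (by omega)
    | succ k ih =>
      intro x y h₁ h₂
      by_cases h₃ : n ≤ x + y + 1
      · exact hs x y h₁ h₃
      rw [shape_eq_back h, shape_eq_back h', ih (x + 1) y (by omega) (by omega),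
        ih x (y + 1) (by omega) (by omega), ih (x + 1) (y + 1) (by omega) (by omega)]
  have key' : ∀ x y, x + y ≤ n → shape X x y = shape X' x y :=
    fun x y hxy => key n x y hxy (by omega)
  ext x y
  by_cases hxy : x + y + 1 < n
  · have h₁ := skel_iff h x y 0
    have h₂ := skel_iff h' x y 0
    rw [key' _ _ (by omega), key' _ _ (by omega), key' _ _ (by omega), ← h₂] at h₁
    exact h₁
  · exact ⟨fun h₁ => absurd (hX x y h₁) hxy, fun h₁ => absurd (hX' x y h₁) hxy⟩

end lis

/-! ### The inverse local rule for abstract labels -/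

section back

variable {b c d : ℕ → ℕ}

theorem back_apply_of_lt {r : ℕ} (h : max (b (r + 1)) (c (r + 1)) < d (r + 1)) :
    back b c d r = min (b r) (c r) - 1 := by simp only [back, if_pos h]

theorem back_apply_of_not_lt {r : ℕ} (h : ¬ max (b (r + 1)) (c (r + 1)) < d (r + 1)) :
    back b c d r = min (b r) (c r) := by simp only [back, if_neg h, Nat.sub_zero]

theorem eq_of_max_lt (hb : Step b d) (hc : Step c d) {p r : ℕ} (hp : max (b p) (c p) < d p)
    (hr : r ≠ p) : b r = d r ∧ c r = d r := by
  by_contra h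
  rcases not_and_or.1 h with h | h
  · exact hr (hb.unique h (by omega))
  · exact hr (hc.unique h (by omega))

theorem back_of_max_lt (hb : Step b d) (hc : Step c d) {r : ℕ} (hr : max (b r) (c r) < d r) :
    back b c d r = b r ∧ b r = c r ∧ d r = b r + 1 := by
  have h₁ := eq_of_max_lt hb hc hr (show r + 1 ≠ r by omega)
  rw [back_apply_of_not_lt (by omega)]
  have := hb.eq_or r
  have := hc.eq_or r
  omega

/-- This is the label form of the definition of `shadow`: cells read off row r + 1 are the shadow of
those read off row r. Antitonicity of `d` makes row r positive, so the truncated subtraction in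
`back` is genuine. -/
theorem max_lt_succ_iff (hb : Step b d) (hc : Step c d) (hd : Antitone d) (r : ℕ) :
    max (b (r + 1)) (c (r + 1)) < d (r + 1) ↔
      b r = back b c d r + 1 ∧ c r = back b c d r + 1 := by
  by_cases h : max (b (r + 1)) (c (r + 1)) < d (r + 1)
  · have h₁ := eq_of_max_lt hb hc h (Nat.succ_ne_self r).symm
    have h₂ := hd (Nat.le_succ r)
    rw [back_apply_of_lt h]
    simp only [h, true_iff]
    simp only [Nat.succ_eq_add_one] at h₂
    omega
  · rw [back_apply_of_not_lt h]
    simp only [h, false_iff]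
    omega

theorem back_comm : back b c d = back c b d := by
  ext r
  simp only [back, min_comm, max_comm]

theorem step_back_left (hb : Step b d) (hc : Step c d) (hd : Antitone d) :
    Step (back b c d) b where
  eq_or r := by
    by_cases h : max (b (r + 1)) (c (r + 1)) < d (r + 1)
    · exact Or.inr ((max_lt_succ_iff hb hc hd r).1 h).1
    · rw [back_apply_of_not_lt h]
      have := hb.eq_or r
      have := hc.eq_or r
      omega
  unique {r s} hr hs := by
    -- If b and c lack the same box of d, in row p, the box removed from b can only be in row p - 1.
    -- Otherwise `back` is the plain minimum, and it differs from b only in rows where c differs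
    -- from d.
    by_cases h : ∃ p, max (b p) (c p) < d p
    · obtain ⟨p, hp⟩ := h
      have key : ∀ r, back b c d r ≠ b r → r + 1 = p := by
        intro r hr
        by_contra hrp
        have h₁ := eq_of_max_lt hb hc hp hrp
        rw [back_apply_of_not_lt (by omega)] at hr
        by_cases hrp' : r = p
        · subst hrp'
          have := hb.eq_or r
          have := hc.eq_or r
          omega
        · have := eq_of_max_lt hb hc hp hrp'
          omega
      have := key r hr
      have := key s hs
      omega
    · push Not at h
      have key : ∀ r, back b c d r ≠ b r → c r ≠ d r := by
        intro r hr
        rw [back_apply_of_not_lt (h (r + 1)).not_gt] at hr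
        have := hb.eq_or r
        omega
      exact hc.unique (key r hr) (key s hs)

theorem step_back_right (hb : Step b d) (hc : Step c d) (hd : Antitone d) :
    Step (back b c d) c := by
  rw [back_comm]
  exact step_back_left hc hb hd

theorem isShape_back (hb : Step b d) (hc : Step c d) (hb' : IsShape b) (hc' : IsShape c)
    (hd : Antitone d) : IsShape (back b c d) where
  antitone := antitone_nat_of_succ_le fun r => by
    have h₁ := hb'.antitone (Nat.le_succ r)
    have h₂ := hc'.antitone (Nat.le_succ r)
    have h₃ := hd (Nat.le_succ r)
    simp only [Nat.succ_eq_add_one] at h₁ h₂ h₃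
    have h₄ : back b c d (r + 1) ≤ min (b (r + 1)) (c (r + 1)) := Nat.sub_le _ _
    by_cases h : max (b (r + 1)) (c (r + 1)) < d (r + 1)
    · have := eq_of_max_lt hb hc h (Nat.succ_ne_self r).symm
      rw [back_apply_of_lt h]
      omega
    · rw [back_apply_of_not_lt h]
      omega
  exists_eq_zero := by
    obtain ⟨i, hi⟩ := hb'.exists_eq_zero
    exact ⟨i, by simp [back, hi]⟩

theorem ne_of_back_ne (hb : Step b d) (hc : Step c d) (hd : Antitone d) (h : back b c d ≠ b) :
    c ≠ d := by
  rintro rfl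
  refine h (funext fun r => ?_)
  rw [back_apply_of_not_lt (by omega)]
  have := hb.eq_or r
  omega

theorem back_eq_of_max_lt (hb : Step b d) (hc : Step c d) (h : max (b 0) (c 0) < d 0) :
    back b c d = b := by
  ext r
  rcases r with _ | r
  · exact (back_of_max_lt hb hc h).1
  · have h₁ := eq_of_max_lt hb hc h (show r + 1 ≠ 0 by omega)
    have h₂ := eq_of_max_lt hb hc h (show r + 1 + 1 ≠ 0 by omega)
    rw [back_apply_of_not_lt (by omega)]
    omega

end back

/-! ### Reconstructing a placement from its boundary labels -/

/-- The labels of a staircase, computed by the inverse local rule from labels `s` on the boundary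
points, which are those with `x + y ∈ {n - 1, n}`. -/
noncomputable def backLabel (n : ℕ) (s : ℕ → ℕ → ℕ → ℕ) (x y : ℕ) : ℕ → ℕ :=
  if n ≤ x + y + 1 then s x y
  else back (backLabel n s (x + 1) y) (backLabel n s x (y + 1)) (backLabel n s (x + 1) (y + 1))
termination_by n - (x + y)

/-- Vacillating sequences of shapes along the boundary of a staircase. -/
structure IsBoundary (n : ℕ) (s : ℕ → ℕ → ℕ → ℕ) : Prop where
  isShape : ∀ x y, IsShape (s x y)
  step_left : ∀ x y, x + 1 + y = n → Step (s x y) (s (x + 1) y)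
  step_right : ∀ x y, x + y + 1 = n → Step (s x y) (s x (y + 1))
  zero_left : s 0 n = 0
  zero_right : s n 0 = 0

namespace IsBoundary

variable {n : ℕ} {s : ℕ → ℕ → ℕ → ℕ}

theorem backLabel_aux (h : IsBoundary n s) (k : ℕ) : ∀ x y, x + y ≤ n → n ≤ x + y + k →
    IsShape (backLabel n s x y) ∧
    (x + 1 + y ≤ n → Step (backLabel n s x y) (backLabel n s (x + 1) y)) ∧
    (x + y + 1 ≤ n → Step (backLabel n s x y) (backLabel n s x (y + 1))) := by
  induction k with
  | zero =>
    intro x y h₁ h₂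
    rw [backLabel, if_pos (by omega)]
    exact ⟨h.isShape x y, by omega, by omega⟩
  | succ k ih =>
    intro x y h₁ h₂
    by_cases h₃ : n ≤ x + y + 1
    · rw [backLabel, if_pos h₃, backLabel, if_pos (by omega), backLabel, if_pos (by omega)]
      exact ⟨h.isShape x y, fun _ => h.step_left x y (by omega),
        fun _ => h.step_right x y (by omega)⟩
    · obtain ⟨hb, -, hb'⟩ := ih (x + 1) y (by omega) (by omega)
      obtain ⟨hc, hc', -⟩ := ih x (y + 1) (by omega) (by omega)
      obtain ⟨hd, -, -⟩ := ih (x + 1) (y + 1) (by omega) (by omega)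
      specialize hb' (by omega)
      specialize hc' (by omega)
      rw [backLabel, if_neg h₃]
      exact ⟨isShape_back hb' hc' hb hc hd.antitone,
        fun _ => step_back_left hb' hc' hd.antitone,
        fun _ => step_back_right hb' hc' hd.antitone⟩

theorem isShape_backLabel (h : IsBoundary n s) {x y : ℕ} (hxy : x + y ≤ n) :
    IsShape (backLabel n s x y) :=
  (h.backLabel_aux n x y hxy (by omega)).1

theorem step_backLabel_left (h : IsBoundary n s) {x y : ℕ} (hxy : x + 1 + y ≤ n) :
    Step (backLabel n s x y) (backLabel n s (x + 1) y) :=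
  (h.backLabel_aux n x y (by omega) (by omega)).2.1 hxy

theorem step_backLabel_right (h : IsBoundary n s) {x y : ℕ} (hxy : x + y + 1 ≤ n) :
    Step (backLabel n s x y) (backLabel n s x (y + 1)) :=
  (h.backLabel_aux n x y (by omega) (by omega)).2.2 hxy

theorem eq_zero_of_step {f : ℕ → ℕ} (h : Step f 0) : f = 0 := by
  ext r
  have := h.eq_or r
  simp only [Pi.zero_apply] at this ⊢
  omega

theorem backLabel_zero_left (h : IsBoundary n s) {y : ℕ} (hy : y ≤ n) : backLabel n s 0 y = 0 := by
  refine Nat.decreasingInduction' (P := fun y => backLabel n s 0 y = 0)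
    (fun k hk _ ih => eq_zero_of_step (ih ▸ h.step_backLabel_right (by omega))) hy ?_
  rw [backLabel, if_pos (by omega), h.zero_left]

theorem backLabel_zero_right (h : IsBoundary n s) {x : ℕ} (hx : x ≤ n) :
    backLabel n s x 0 = 0 := by
  refine Nat.decreasingInduction' (P := fun x => backLabel n s x 0 = 0)
    (fun k hk _ ih => eq_zero_of_step (ih ▸ h.step_backLabel_left (by omega))) hx ?_
  rw [backLabel, if_pos (by omega), h.zero_right]

theorem backLabel_eq (x y : ℕ) (hxy : x + y + 1 < n) : backLabel n s x y =
    back (backLabel n s (x + 1) y) (backLabel n s x (y + 1)) (backLabel n s (x + 1) (y + 1)) := by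
  rw [backLabel, if_neg (by omega)]

end IsBoundary

/-- The placement with labels `s` on the boundary of the staircase. -/
def backCells (n : ℕ) (s : ℕ → ℕ → ℕ → ℕ) (x y : ℕ) : Prop :=
  x + y + 1 < n ∧ max (backLabel n s (x + 1) y 0) (backLabel n s x (y + 1) 0) <
    backLabel n s (x + 1) (y + 1) 0

namespace IsBoundary

variable {n : ℕ} {s : ℕ → ℕ → ℕ → ℕ}

/-- Once a column contains a cell, its two sides carry different labels at all greater heights, by
`ne_of_back_ne`. A second cell would force them to agree, so columns hold at most one cell. -/
theorem backLabel_ne (h : IsBoundary n s) {x y v : ℕ} (hX : backCells n s x v) (hv : v < y)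
    (hy : x + y + 1 ≤ n) : backLabel n s x y ≠ backLabel n s (x + 1) y := by
  induction y with
  | zero => omega
  | succ y ih =>
    rcases Nat.lt_succ_iff_lt_or_eq.1 hv with hv | rfl
    · have h₁ := ih hv (by omega)
      rw [backLabel_eq x y (by omega)] at h₁
      exact ne_of_back_ne (h.step_backLabel_right (by omega)) (h.step_backLabel_left (by omega))
        (h.isShape_backLabel (by omega)).antitone h₁
    · intro h'
      have := hX.2
      rw [h'] at this
      omega

theorem backLabel_ne' (h : IsBoundary n s) {x y u : ℕ} (hX : backCells n s u y) (hu : u < x)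
    (hx : x + y + 1 ≤ n) : backLabel n s x y ≠ backLabel n s x (y + 1) := by
  induction x with
  | zero => omega
  | succ x ih =>
    rcases Nat.lt_succ_iff_lt_or_eq.1 hu with hu | rfl
    · have h₁ := ih hu (by omega)
      rw [backLabel_eq x y (by omega), back_comm] at h₁
      exact ne_of_back_ne (h.step_backLabel_left (by omega)) (h.step_backLabel_right (by omega))
        (h.isShape_backLabel (by omega)).antitone h₁
    · intro h'
      have := hX.2
      rw [h'] at this
      omega

theorem isPlacement_backCells (h : IsBoundary n s) : IsPlacement (backCells n s) := by
  have key : ∀ {x y}, backCells n s x y → backLabel n s x y = backLabel n s (x + 1) y ∧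
      backLabel n s x y = backLabel n s x (y + 1) := by
    rintro x y ⟨h₁, h₂⟩
    have hb : Step (backLabel n s (x + 1) y) _ := h.step_backLabel_right (by omega)
    have hc : Step (backLabel n s x (y + 1)) _ := h.step_backLabel_left (by omega)
    rw [backLabel_eq x y h₁]
    refine ⟨back_eq_of_max_lt hb hc h₂, ?_⟩
    rw [back_comm]
    exact back_eq_of_max_lt hc hb (by rwa [max_comm])
  constructor
  · intro x y y' h₁ h₂
    rcases lt_trichotomy y y' with hy | hy | hy
    · exact absurd (key h₂).1 (h.backLabel_ne h₁ hy h₂.1.le)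
    · exact hy
    · exact absurd (key h₁).1 (h.backLabel_ne h₂ hy h₁.1.le)
  · intro x x' y h₁ h₂
    rcases lt_trichotomy x x' with hx | hx | hx
    · exact absurd (key h₂).2 (h.backLabel_ne' h₁ hx h₂.1.le)
    · exact hx
    · exact absurd (key h₁).2 (h.backLabel_ne' h₂ hx h₁.1.le)

/-- The recursion of `lis` is the forward local rule in a single row: add one at a cell, take the
maximum elsewhere. The labels obey the same recursion and vanish on the axes. -/
theorem lis_eq_of_local {Y : ℕ → ℕ → Prop} (h : IsBoundary n s) (r : ℕ)
    (hY : ∀ x y, x + y + 1 < n → (Y x y ↔ max (backLabel n s (x + 1) y r)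
      (backLabel n s x (y + 1) r) < backLabel n s (x + 1) (y + 1) r)) :
    ∀ x y, x + y ≤ n → lis Y x y = backLabel n s x y r := by
  intro x y hxy
  induction hs : x + y using Nat.strong_induction_on generalizing x y with
  | _ m ih =>
    subst hs
    rcases x with _ | x
    · simp [h.backLabel_zero_left (y := y) (by omega)]
    rcases y with _ | y
    · simp [h.backLabel_zero_right (x := x + 1) (by omega)]
    have h₀ := ih (x + y) (by omega) x y (by omega) rfl
    have h₁ := ih (x + 1 + y) (by omega) (x + 1) y (by omega) rfl
    have h₂ := ih (x + (y + 1)) (by omega) x (y + 1) (by omega) rfl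
    have h₃ := hY x y (by omega)
    have hb : Step (backLabel n s (x + 1) y) _ := h.step_backLabel_right (by omega)
    have hc : Step (backLabel n s x (y + 1)) _ := h.step_backLabel_left (by omega)
    by_cases hX : Y x y
    · have := back_of_max_lt hb hc (h₃.1 hX)
      rw [lis_succ_of_mem hX, h₀, backLabel_eq x y (by omega)]
      omega
    · have := mt h₃.2 hX
      have := hb.eq_or r
      have := hc.eq_or r
      rw [lis_succ_of_notMem hX]
      omega

theorem skel_backCells (h : IsBoundary n s) (r : ℕ) : ∀ x y, x + y + 1 < n →
    (skel (backCells n s) r x y ↔ max (backLabel n s (x + 1) y r)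
      (backLabel n s x (y + 1) r) < backLabel n s (x + 1) (y + 1) r) := by
  induction r with
  | zero => exact fun x y hxy => ⟨fun h' => h'.2, fun h' => ⟨hxy, h'⟩⟩
  | succ r ih =>
    intro x y hxy
    have key := h.lis_eq_of_local r ih
    rw [max_lt_succ_iff (h.step_backLabel_right (by omega)) (h.step_backLabel_left (by omega))
      (h.isShape_backLabel (by omega)).antitone r, ← backLabel_eq x y hxy]
    change lis _ _ _ = _ ∧ lis _ _ _ = _ ↔ _
    rw [key x y (by omega), key (x + 1) y (by omega), key x (y + 1) (by omega)]

/-- Every vacillating boundary sequence comes from a placement in the staircase. -/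
theorem exists_placement (h : IsBoundary n s) : ∃ X : ℕ → ℕ → Prop, IsPlacement X ∧
    (∀ x y, X x y → x + y + 1 < n) ∧
    ∀ x y, x + y ≤ n → n ≤ x + y + 1 → shape X x y = s x y := by
  refine ⟨backCells n s, h.isPlacement_backCells, fun x y hX => hX.1, fun x y h₁ h₂ => ?_⟩
  ext r
  rw [shape, h.lis_eq_of_local r (h.skel_backCells r) x y h₁, backLabel, if_pos h₂]

end IsBoundary

/-! ### Conjugation of shapes -/

/-- The conjugate of a shape. -/
noncomputable def conj (f : ℕ → ℕ) (j : ℕ) : ℕ := sInf {i | f i ≤ j}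

namespace IsShape

variable {f g : ℕ → ℕ}

theorem conj_le_iff (h : IsShape f) {i j : ℕ} : conj f j ≤ i ↔ f i ≤ j := by
  have hne : {i | f i ≤ j}.Nonempty := by
    obtain ⟨i, hi⟩ := h.exists_eq_zero
    exact ⟨i, by simp [hi]⟩
  refine ⟨fun h' => (h.antitone h').trans (Nat.sInf_mem hne), fun h' => Nat.sInf_le h'⟩

theorem conj (h : IsShape f) : IsShape (conj f) where
  antitone _ _ hij := h.conj_le_iff.2 ((h.conj_le_iff.1 le_rfl).trans hij)
  exists_eq_zero := ⟨f 0, by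
    have := h.conj_le_iff.2 (le_refl (f 0))
    omega⟩

theorem conj_conj (h : IsShape f) : _root_.conj (_root_.conj f) = f := by
  ext i
  exact eq_of_forall_ge_iff fun j => by rw [h.conj.conj_le_iff, h.conj_le_iff]

theorem step_conj (hf : IsShape f) (hg : IsShape g) (h : Step f g) :
    Step (_root_.conj f) (_root_.conj g) := by
  have hle : ∀ j, _root_.conj f j ≤ _root_.conj g j := fun j => by
    rw [hf.conj_le_iff]
    have := hg.conj_le_iff.1 (le_refl (_root_.conj g j))
    have := h.eq_or (_root_.conj g j)
    omega
  -- Where column j grows, the new box lies in row `conj f j` and column j. Two new boxes in one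
  -- column, or new boxes in two columns, would contradict that only one box is added.
  have key : ∀ j, _root_.conj f j < _root_.conj g j →
      f (_root_.conj f j) = j ∧ g (_root_.conj f j) = j + 1 := fun j hj => by
    have h₁ := hf.conj_le_iff.1 (le_refl (_root_.conj f j))
    have h₂ := mt hg.conj_le_iff.2 (not_le.2 hj)
    have := h.eq_or (_root_.conj f j)
    omega
  constructor
  · intro j
    have h₁ := hle j
    by_contra hne
    have h₂ := key j (by omega)
    have h₃ := mt (hg.conj_le_iff (i := _root_.conj f j + 1) (j := j)).2 (by omega)
    have h₄ := hf.antitone (Nat.le_succ (_root_.conj f j))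
    have := h.unique (r := _root_.conj f j) (s := _root_.conj f j + 1) (by omega)
      (by simp only [Nat.succ_eq_add_one] at h₄; omega)
    omega
  · intro i j hi hj
    have h₁ := key i (lt_of_le_of_ne (hle i) hi)
    have h₂ := key j (lt_of_le_of_ne (hle j) hj)
    have h₃ := h.unique (r := _root_.conj f i) (s := _root_.conj f j) (by omega) (by omega)
    rw [← h₁.1, ← h₂.1, h₃]

end IsShape

@[simp] theorem conj_zero : conj 0 = 0 := by
  ext j
  simp [conj]

/-! ### Chains and shapes: first row and first column -/

section chains

variable {X : ℕ → ℕ → Prop}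

/-- `X` has an increasing chain of `m` cells in `[0, x) × [0, y)`. -/
def IncChain (X : ℕ → ℕ → Prop) (x y m : ℕ) : Prop :=
  ∃ p q : Fin m → ℕ, StrictMono p ∧ StrictMono q ∧ ∀ r, X (p r) (q r) ∧ p r < x ∧ q r < y

/-- `X` has a decreasing chain of `m` cells in `[0, x) × [0, y)`. -/
def DecChain (X : ℕ → ℕ → Prop) (x y m : ℕ) : Prop :=
  ∃ p q : Fin m → ℕ, StrictMono p ∧ StrictAnti q ∧ ∀ r, X (p r) (q r) ∧ p r < x ∧ q r < y

theorem exists_cell_of_lt_lis {k x y : ℕ} (hk : k < lis X x y) :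
    ∃ u < x, ∃ v < y, X u v ∧ k ≤ lis X u v := by
  induction h : x + y using Nat.strong_induction_on generalizing x y with
  | _ s ih =>
    subst h
    rcases x with _ | x
    · simp at hk
    rcases y with _ | y
    · simp at hk
    by_cases hX : X x y
    · rw [lis_succ_of_mem hX] at hk
      exact ⟨x, by omega, y, by omega, hX, by omega⟩
    · rw [lis_succ_of_notMem hX, lt_max_iff] at hk
      rcases hk with hk | hk
      · obtain ⟨u, hu, v, hv, h'⟩ := ih (x + 1 + y) (by omega) hk rfl
        exact ⟨u, hu, v, by omega, h'⟩
      · obtain ⟨u, hu, v, hv, h'⟩ := ih (x + (y + 1)) (by omega) hk rfl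
        exact ⟨u, by omega, v, hv, h'⟩

theorem IsPlacement.lis_mono (h : IsPlacement X) {x x' y y' : ℕ} (hx : x ≤ x') (hy : y ≤ y') :
    lis X x y ≤ lis X x' y' := by
  have h₁ : Monotone fun x => lis X x y := monotone_nat_of_le_succ fun x => by
    have := h.lis_succ_left x y
    omega
  have h₂ : Monotone fun y => lis X x' y := monotone_nat_of_le_succ fun y => by
    have := h.lis_succ_right x' y
    omega
  exact (h₁ hx).trans (h₂ hy)

theorem strictMono_snoc {m u : ℕ} {p : Fin m → ℕ} (hp : StrictMono p) (h : ∀ r, p r < u) :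
    StrictMono (Fin.snoc p u : Fin (m + 1) → ℕ) := by
  intro a b hab
  induction a using Fin.lastCases with
  | last => exact absurd (Fin.le_last b) hab.not_ge
  | cast a =>
    induction b using Fin.lastCases with
    | last => simpa using h a
    | cast b => simpa using hp (Fin.castSucc_lt_castSucc_iff.1 hab)

theorem IsPlacement.le_lis_iff (h : IsPlacement X) {m x y : ℕ} :
    m ≤ lis X x y ↔ IncChain X x y m := by
  constructor
  · intro hm
    induction m generalizing x y with
    | zero => exact ⟨Fin.elim0, Fin.elim0, fun r => r.elim0, fun r => r.elim0, fun r => r.elim0⟩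
    | succ m ih =>
      obtain ⟨u, hu, v, hv, hX, hk⟩ := exists_cell_of_lt_lis hm
      obtain ⟨p, q, hp, hq, hpq⟩ := ih hk
      refine ⟨Fin.snoc p u, Fin.snoc q v, ?_, ?_, ?_⟩
      · exact strictMono_snoc hp fun r => (hpq r).2.1
      · exact strictMono_snoc hq fun r => (hpq r).2.2
      · intro r
        refine Fin.lastCases ?_ (fun r => ?_) r
        · simp [hX, hu, hv]
        · have := hpq r
          simp only [Fin.snoc_castSucc]
          exact ⟨this.1, by omega, by omega⟩
  · rintro ⟨p, q, hp, hq, hpq⟩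
    have key : ∀ r : Fin m, (r : ℕ) + 1 ≤ lis X (p r + 1) (q r + 1) := by
      rintro ⟨r, hr⟩
      induction r with
      | zero =>
        rw [lis_succ_of_mem (hpq _).1]
        simp
      | succ r ih =>
        have h₁ := ih (by omega)
        have h₂ : p ⟨r, by omega⟩ < p ⟨r + 1, hr⟩ := hp (by simp)
        have h₃ : q ⟨r, by omega⟩ < q ⟨r + 1, hr⟩ := hq (by simp)
        have h₄ := h.lis_mono (Nat.succ_le_of_lt h₂) (Nat.succ_le_of_lt h₃)
        rw [lis_succ_of_mem (hpq _).1]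
        simp only [Nat.succ_eq_add_one] at h₄ h₁ ⊢
        omega
    rcases m with _ | m
    · omega
    · have h₁ := key (Fin.last m)
      have h₂ := hpq (Fin.last m)
      refine h₁.trans (h.lis_mono (by omega) (by omega))

/-- The candidates are the cell below the first shadow cell and the cell left of the second. If
neither lies between, `lis` rises along both edges at (x₁, y₂), giving column x₁ a second shadow
cell. -/
theorem IsPlacement.exists_cell_between (h : IsPlacement X) {x₁ y₁ x₂ y₂ : ℕ}
    (h₁ : shadow X x₁ y₁) (h₂ : shadow X x₂ y₂) (hx : x₁ < x₂) (hy : y₂ < y₁) :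
    ∃ u v, X u v ∧ x₁ ≤ u ∧ v < y₁ ∧ u < x₂ ∧ y₂ ≤ v := by
  obtain ⟨v, hv, hXv⟩ := h.exists_lt_of_shadow h₁
  obtain ⟨u, hu, hXu⟩ := h.swap.exists_lt_of_shadow ((shadow_swap X y₂ x₂).2 h₂)
  by_cases hv' : y₂ ≤ v
  · exact ⟨x₁, v, hXv, le_rfl, hv, hx, hv'⟩
  by_cases hu' : x₁ ≤ u
  · exact ⟨u, y₂, hXu, hu', hy, hu, le_rfl⟩
  push Not at hv' hu'
  refine absurd ⟨h.lis_left_of_lt hXv hv' fun w hw => h.not_shadow_of_lt h₁ (hw.trans hy), ?_⟩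
    (h.not_shadow_of_lt h₁ hy)
  have := h.swap.lis_left_of_lt (x := y₂) (y := x₁) hXu hu' fun w hw =>
    h.swap.not_shadow_of_lt ((shadow_swap X y₂ x₂).2 h₂) (hw.trans hx)
  simpa only [lis_swap] using this

/-- Without such a shadow cell, column u' below v and row v left of u' contain cells but no shadow
cells. Then `lis` rises along both edges at (u', v), which is itself a shadow cell of the required
kind. -/
theorem IsPlacement.exists_shadow_between (h : IsPlacement X) {u v u' v' : ℕ}
    (h₁ : X u v) (h₂ : X u' v') (hu : u < u') (hv : v' < v) :
    ∃ x y, shadow X x y ∧ u < x ∧ y ≤ v ∧ x ≤ u' ∧ v' < y := by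
  by_contra! hne
  have h₃ : ¬ shadow X u' v := fun hs => (hne u' v hs hu le_rfl le_rfl).not_gt hv
  have h₄ : ∀ w < v, ¬ shadow X u' w := by
    intro w hw hs
    have h₅ := hne u' w hs hu hw.le le_rfl
    obtain ⟨z, hz, hz'⟩ := h.exists_lt_of_shadow hs
    have := h.snd_unique hz' h₂
    omega
  have h₅ : ∀ w < u', ¬ shadow X w v := by
    intro w hw hs
    obtain ⟨z, hz, hz'⟩ := h.swap.exists_lt_of_shadow ((shadow_swap X v w).2 hs)
    have := h.fst_unique hz' h₁
    have := hne w v hs (by omega) le_rfl hw.le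
    omega
  refine h₃ ⟨h.lis_left_of_lt h₂ hv h₄, ?_⟩
  have := h.swap.lis_left_of_lt (x := v) (y := u') (v := u) h₁ hu
    fun w hw => mt (shadow_swap X v w).1 (h₅ w hw)
  simpa only [lis_swap] using this

theorem IsPlacement.decChain_shadow_iff (h : IsPlacement X) {x y m : ℕ} :
    DecChain (shadow X) x y (m + 1) ↔ DecChain X x y (m + 2) := by
  constructor
  · rintro ⟨p, q, hp, hq, hpq⟩
    -- The m + 2 cells interlace the m + 1 shadow cells: one lies left of the first in its row, one
    -- below the last in its column, and one between each consecutive pair.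
    have key : ∀ i : Fin (m + 2), ∃ u v, X u v ∧ u < x ∧ v < y ∧
        (∀ r : Fin (m + 1), r.succ = i → p r ≤ u ∧ v < q r) ∧
        (∀ r : Fin (m + 1), r.castSucc = i → u < p r ∧ q r ≤ v) := by
      intro i
      induction i using Fin.cases with
      | zero =>
        obtain ⟨h₁, h₂, h₃⟩ := hpq 0
        obtain ⟨u, hu, hu'⟩ := h.swap.exists_lt_of_shadow ((shadow_swap X _ _).2 h₁)
        refine ⟨u, q 0, hu', by omega, h₃, fun r hr => absurd hr (Fin.succ_ne_zero r), ?_⟩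
        intro r hr
        obtain rfl : r = 0 := Fin.castSucc_injective _ hr
        exact ⟨hu, le_rfl⟩
      | succ i =>
        induction i using Fin.lastCases with
        | last =>
          obtain ⟨h₁, h₂, h₃⟩ := hpq (Fin.last m)
          obtain ⟨v, hv, hv'⟩ := h.exists_lt_of_shadow h₁
          refine ⟨p (Fin.last m), v, hv', h₂, by omega, ?_, ?_⟩
          · intro r hr
            rw [Fin.succ_injective _ hr]
            exact ⟨le_rfl, hv⟩
          · intro r hr
            rw [Fin.succ_last] at hr
            exact absurd hr (Fin.castSucc_lt_last r).ne
        | cast i =>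
          have hi : i.castSucc < i.succ := Fin.castSucc_lt_succ
          obtain ⟨u, v, hX, h₁, h₂, h₃, h₄⟩ := h.exists_cell_between (hpq i.castSucc).1
            (hpq i.succ).1 (hp hi) (hq hi)
          refine ⟨u, v, hX, h₃.trans (hpq _).2.1, h₂.trans (hpq _).2.2, ?_, ?_⟩
          · intro r hr
            rw [Fin.succ_injective _ hr]
            exact ⟨h₁, h₂⟩
          · intro r hr
            rw [Fin.succ_castSucc] at hr
            rw [Fin.castSucc_injective _ hr]
            exact ⟨h₃, h₄⟩
    choose u v hX hu hv h₁ h₂ using key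
    refine ⟨u, v, Fin.strictMono_iff_lt_succ.2 fun i => ?_,
      Fin.strictAnti_iff_succ_lt.2 fun i => ?_, fun r => ⟨hX r, hu r, hv r⟩⟩
    · exact (h₂ _ i rfl).1.trans_le (h₁ _ i rfl).1
    · exact (h₁ _ i rfl).2.trans_le (h₂ _ i rfl).2
  · rintro ⟨p, q, hp, hq, hpq⟩
    have key : ∀ i : Fin (m + 1), _ := fun i =>
      h.exists_shadow_between (hpq i.castSucc).1 (hpq i.succ).1 (hp Fin.castSucc_lt_succ)
        (hq Fin.castSucc_lt_succ)
    choose u v hX h₁ h₂ h₃ h₄ using key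
    refine ⟨u, v, Fin.strictMono_iff_lt_succ.2 fun i => ?_,
      Fin.strictAnti_iff_succ_lt.2 fun i => ?_, fun r => ⟨hX r, ?_, ?_⟩⟩
    · have := h₃ i.castSucc
      have := h₁ i.succ
      rw [← Fin.succ_castSucc] at this
      omega
    · have := h₄ i.castSucc
      have := h₂ i.succ
      rw [← Fin.succ_castSucc] at this
      omega
    · exact (h₃ r).trans_lt (hpq _).2.1
    · exact (h₂ r).trans_lt (hpq _).2.2

theorem decChain_one_iff {x y : ℕ} : DecChain X x y 1 ↔ IncChain X x y 1 := by
  constructor <;> rintro ⟨p, q, -, -, h⟩ <;>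
    exact ⟨p, q, Subsingleton.strictMono _, by
      first | exact Subsingleton.strictMono _ | exact Subsingleton.strictAnti _, h⟩

/-- Taking m shadows shortens a decreasing chain of m + 1 cells to a single cell, so it exists
exactly when level m is nonempty in the rectangle. -/
theorem decChain_succ_iff (h : IsPlacement X) {x y m : ℕ} :
    DecChain X x y (m + 1) ↔ 0 < shape X x y m := by
  induction m generalizing X with
  | zero => rw [decChain_one_iff, ← h.le_lis_iff]; rfl
  | succ m ih =>
    rw [← h.decChain_shadow_iff, ih h.isPlacement_shadow]
    have : ∀ m, skel (shadow X) m = skel X (m + 1) := by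
      intro m
      induction m with
      | zero => rfl
      | succ m ih => rw [skel, ih]; rfl
    simp only [shape, this]

theorem incChain_iff (h : IsPlacement X) {x y m : ℕ} :
    IncChain X x y m ↔ m ≤ shape X x y 0 := h.le_lis_iff.symm

theorem decChain_iff (h : IsPlacement X) {x y m : ℕ} :
    DecChain X x y m ↔ m ≤ conj (shape X x y) 0 := by
  rcases m with _ | m
  · simp only [Nat.zero_le, iff_true]
    exact ⟨Fin.elim0, Fin.elim0, fun r => r.elim0, fun r => r.elim0, fun r => r.elim0⟩
  · have := (isShape_shape h x y).conj_le_iff (i := m) (j := 0)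
    rw [decChain_succ_iff h]
    omega

end chains

/-! ### Set partitions and their arcs -/

namespace SetPartition

variable {n : ℕ} {P Q : SetPartition n}

theorem IsArc.mem_Icc {i j : ℕ} (h : P.IsArc i j) : 1 ≤ i ∧ i < j ∧ j ≤ n := by
  obtain ⟨hij, B, hB, hi, hj, -⟩ := h
  have h₁ := Finset.mem_Icc.1 (P.le hB hi)
  have h₂ := Finset.mem_Icc.1 (P.le hB hj)
  exact ⟨h₁.1, hij, h₂.2⟩

theorem IsArc.right_unique {i j j' : ℕ} (h : P.IsArc i j) (h' : P.IsArc i j') : j = j' := by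
  obtain ⟨hij, B, hB, hi, hj, hm⟩ := h
  obtain ⟨hij', B', hB', hi', hj', hm'⟩ := h'
  obtain rfl := P.eq_of_mem_parts hB hB' hi hi'
  have := hm _ hj'
  have := hm' _ hj
  omega

theorem IsArc.left_unique {i i' j : ℕ} (h : P.IsArc i j) (h' : P.IsArc i' j) : i = i' := by
  obtain ⟨hij, B, hB, hi, hj, hm⟩ := h
  obtain ⟨hij', B', hB', hi', hj', hm'⟩ := h'
  obtain rfl := P.eq_of_mem_parts hB hB' hj hj'
  have := hm _ hi'
  have := hm' _ hi
  omega

theorem mem_of_isArc_imp (h : ∀ i j, P.IsArc i j → Q.IsArc i j) {B C : Finset ℕ}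
    (hB : B ∈ P.parts) (hC : C ∈ Q.parts) (d : ℕ) :
    ∀ i j, j - i = d → i ≤ j → i ∈ B → j ∈ B → i ∈ C → j ∈ C := by
  induction d using Nat.strong_induction_on with
  | _ d ih =>
    rintro i j rfl hij hi hj hiC
    rcases hij.eq_or_lt with rfl | hij
    · exact hiC
    classical
    -- The next element of B after i is joined to i by an arc of P, hence of Q, so it stays in C and
    -- is closer to j.
    have hex : ∃ m, i < m ∧ m ∈ B := ⟨j, hij, hj⟩
    obtain ⟨h₁, h₂⟩ := Nat.find_spec hex
    have h₃ : Nat.find hex ≤ j := Nat.find_min' hex ⟨hij, hj⟩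
    have harc : P.IsArc i (Nat.find hex) :=
      ⟨h₁, B, hB, hi, h₂, fun m hm hm' => Nat.find_min hex hm'.2 ⟨hm'.1, hm⟩⟩
    obtain ⟨-, C', hC', hiC', hmC', -⟩ := h _ _ harc
    obtain rfl := Q.eq_of_mem_parts hC hC' hiC hiC'
    exact ih _ (by omega) _ j rfl h₃ h₂ hj hmC'

theorem mem_of_isArc_imp' (h : ∀ i j, P.IsArc i j → Q.IsArc i j) {B C : Finset ℕ}
    (hB : B ∈ P.parts) (hC : C ∈ Q.parts) {i j : ℕ} (hi : i ∈ B) (hj : j ∈ B) (hiC : i ∈ C) :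
    j ∈ C := by
  rcases le_total i j with hij | hij
  · exact mem_of_isArc_imp h hB hC _ i j rfl hij hi hj hiC
  · obtain ⟨D, hD, hjD⟩ := Q.exists_mem (P.le hB hj)
    have := mem_of_isArc_imp h hB hD _ j i rfl hij hj hi hjD
    rwa [Q.eq_of_mem_parts hC hD hiC this]

/-- A set partition is determined by its arcs. -/
theorem ext_isArc (h : ∀ i j, P.IsArc i j ↔ Q.IsArc i j) : P = Q := by
  have key : ∀ P Q : SetPartition n, (∀ i j, P.IsArc i j ↔ Q.IsArc i j) → P.parts ⊆ Q.parts := by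
    intro P Q h B hB
    obtain ⟨i, hi⟩ := P.nonempty_of_mem_parts hB
    obtain ⟨C, hC, hiC⟩ := Q.exists_mem (P.le hB hi)
    have : B = C := by
      ext j
      exact ⟨fun hj => mem_of_isArc_imp' (fun i j => (h i j).1) hB hC hi hj hiC,
        fun hj => mem_of_isArc_imp' (fun i j => (h i j).2) hC hB hiC hj hi⟩
    exact this ▸ hC
  exact Finpartition.ext ((key P Q h).antisymm (key Q P fun i j => (h i j).symm))

section ofArcs

open Classical in
/-- The least element of the component of `j` in the graph of arcs `R`. -/
noncomputable def root (R : ℕ → ℕ → Prop) (j : ℕ) : ℕ :=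
  if h : ∃ i < j, R i j then root R h.choose else j
termination_by j
decreasing_by exact h.choose_spec.1

variable {R : ℕ → ℕ → Prop}

theorem root_le (R : ℕ → ℕ → Prop) (j : ℕ) : root R j ≤ j := by
  induction j using Nat.strong_induction_on with
  | _ j ih =>
    rw [root]
    split_ifs with h
    · exact (ih _ h.choose_spec.1).trans h.choose_spec.1.le
    · exact le_rfl

theorem root_eq (hlt : ∀ i j, R i j → i < j) (hl : ∀ i i' j, R i j → R i' j → i = i') {i j : ℕ}
    (h : R i j) : root R j = root R i := by
  have hex : ∃ i < j, R i j := ⟨i, hlt i j h, h⟩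
  rw [root, dif_pos hex, hl _ _ _ hex.choose_spec.2 h]

theorem exists_of_root_lt {j : ℕ} (h : root R j < j) : ∃ i, R i j := by
  by_contra hne
  rw [root, dif_neg fun ⟨i, _, hi⟩ => hne ⟨i, hi⟩] at h
  exact h.false

/-- Step back from a along its incoming arc (e, a). If e < c, induction gives an arc from e ending
by c, contradicting uniqueness of right ends. If e = c the arc is found, and if c < e induction
applies to c and e. -/
theorem exists_of_root_eq (hlt : ∀ i j, R i j → i < j) (hl : ∀ i i' j, R i j → R i' j → i = i')
    (hr : ∀ i j j', R i j → R i j' → j = j') (a : ℕ) :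
    ∀ c < a, root R c = root R a → ∃ d, R c d ∧ d ≤ a := by
  induction a using Nat.strong_induction_on with
  | _ a ih =>
    intro c hc hca
    obtain ⟨e, he⟩ := exists_of_root_lt (R := R) (j := a) (by have := root_le R c; omega)
    have hea := hlt e a he
    have hre := root_eq hlt hl he
    rcases lt_trichotomy e c with hec | rfl | hec
    · obtain ⟨d, hd, hdc⟩ := ih c hc e hec (by rw [hca, hre])
      have := hr _ _ _ hd he
      omega
    · exact ⟨a, he, le_rfl⟩
    · obtain ⟨d, hd, hde⟩ := ih e hea c hec (by rw [hca, hre])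
      exact ⟨d, hd, by omega⟩

/-- Every set of arcs in which each point is the left end and the right end of at most one arc
comes from a set partition. -/
theorem exists_isArc_iff (hlt : ∀ i j, R i j → 1 ≤ i ∧ i < j ∧ j ≤ n)
    (hl : ∀ i i' j, R i j → R i' j → i = i') (hr : ∀ i j j', R i j → R i j' → j = j') :
    ∃ P : SetPartition n, ∀ i j, P.IsArc i j ↔ R i j := by
  classical
  have hlt' : ∀ i j, R i j → i < j := fun i j h => (hlt i j h).2.1
  refine ⟨Finpartition.ofSetSetoid (Setoid.ker (root R)) (Finset.Icc 1 n), fun i j => ?_⟩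
  have hparts : ∀ B, B ∈ (Finpartition.ofSetSetoid (Setoid.ker (root R)) (Finset.Icc 1 n)).parts ↔
      ∃ a ∈ Finset.Icc 1 n, (Finset.Icc 1 n).filter (fun b => root R a = root R b) = B := by
    intro B
    simp only [Finpartition.ofSetSetoid, Finset.mem_image]
    simp only [Setoid.ker_def]
  constructor
  · rintro ⟨hij, B, hB, hi, hj, hm⟩
    obtain ⟨a, ha, rfl⟩ := (hparts B).1 hB
    simp only [Finset.mem_filter] at hi hj hm
    obtain ⟨d, hd, hdj⟩ := exists_of_root_eq hlt' hl hr j i hij (by rw [← hi.2, hj.2])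
    have h₁ := hm d ⟨by have := hlt _ _ hd; simp only [Finset.mem_Icc]; omega, by
      rw [root_eq hlt' hl hd, hi.2]⟩
    have := hlt' _ _ hd
    obtain rfl : d = j := by omega
    exact hd
  · intro h
    have h₁ := hlt i j h
    refine ⟨h₁.2.1, _, (hparts _).2 ⟨i, by simp only [Finset.mem_Icc]; omega, rfl⟩, ?_, ?_, ?_⟩
    · simp only [Finset.mem_filter, Finset.mem_Icc, and_true]
      omega
    · simp only [Finset.mem_filter, Finset.mem_Icc, root_eq hlt' hl h, and_true]
      omega
    · rintro m hm ⟨him, hmj⟩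
      obtain ⟨d, hd, hdm⟩ := exists_of_root_eq hlt' hl hr m i him (Finset.mem_filter.1 hm).2
      have := hr _ _ _ hd h
      omega

end ofArcs

/-! ### Arcs as cells; crossings and nestings as chains -/

/-- The arcs of `P`, as cells of a staircase: the arc `(i, j)` is the cell `(i - 1, n - j)`. -/
def cells (P : SetPartition n) (x y : ℕ) : Prop := P.IsArc (x + 1) (n - y)

theorem isPlacement_cells (P : SetPartition n) : IsPlacement P.cells where
  snd_unique h h' := by
    have := IsArc.right_unique h h'
    have := IsArc.mem_Icc h
    have := IsArc.mem_Icc h'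
    omega
  fst_unique h h' := by
    have := IsArc.left_unique h h'
    omega

theorem cells_lt (P : SetPartition n) (x y : ℕ) (h : P.cells x y) : x + y + 1 < n := by
  have := IsArc.mem_Icc h
  omega

theorem isArc_iff_cells {i j : ℕ} (hi : 1 ≤ i) (hj : j ≤ n) :
    P.IsArc i j ↔ P.cells (i - 1) (n - j) := by
  rw [cells, Nat.sub_add_cancel hi, Nat.sub_sub_self hj]

theorem cells_injective (h : P.cells = Q.cells) : P = Q := by
  refine ext_isArc fun i j => ?_
  by_cases hij : 1 ≤ i ∧ j ≤ n
  · rw [isArc_iff_cells hij.1 hij.2, isArc_iff_cells hij.1 hij.2, h]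
  · exact ⟨fun h => absurd ⟨h.mem_Icc.1, h.mem_Icc.2.2⟩ hij,
      fun h => absurd ⟨h.mem_Icc.1, h.mem_Icc.2.2⟩ hij⟩

theorem exists_cells_eq {X : ℕ → ℕ → Prop} (h : IsPlacement X)
    (hX : ∀ x y, X x y → x + y + 1 < n) : ∃ P : SetPartition n, P.cells = X := by
  obtain ⟨P, hP⟩ := exists_isArc_iff (n := n)
    (R := fun i j => 1 ≤ i ∧ j ≤ n ∧ X (i - 1) (n - j))
    (fun i j h' => by have := hX _ _ h'.2.2; omega)
    (fun i i' j h₁ h₂ => by have := h.fst_unique h₁.2.2 h₂.2.2; omega)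
    (fun i j j' h₁ h₂ => by have := h.snd_unique h₁.2.2 h₂.2.2; omega)
  refine ⟨P, ?_⟩
  ext x y
  rw [cells, hP]
  constructor
  · rintro ⟨-, -, h'⟩
    have := hX _ _ h'
    simp only [Nat.add_sub_cancel] at h' this
    -- Subtraction truncates: for y > n the cell (x, n - (n - y)) is (x, n), outside the staircase.
    by_cases hy : y ≤ n
    · rwa [Nat.sub_sub_self hy] at h'
    · omega
  · intro h'
    have := hX _ _ h'
    refine ⟨by omega, by omega, ?_⟩
    rwa [Nat.add_sub_cancel, Nat.sub_sub_self (by omega)]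

/-- With t the largest left end, every arc spans the gap after t. The corresponding cells therefore
lie in [0, t) × [0, n - t). -/
theorem exists_between_ends {m : ℕ} {i j : Fin m → ℕ} (h : ∀ r, P.IsArc (i r) (j r))
    (hi : StrictMono i) (hij : ∀ r s, i r < j s) :
    ∃ t ≤ n, (∀ r, i r ≤ t) ∧ ∀ r, t < j r := by
  rcases m with _ | m
  · exact ⟨0, Nat.zero_le n, fun r => r.elim0, fun r => r.elim0⟩
  · exact ⟨i (Fin.last m), by have := (h (Fin.last m)).mem_Icc; omega,
      fun r => hi.monotone (Fin.le_last r), fun r => hij _ r⟩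

theorem hasNesting_iff {m : ℕ} :
    P.HasNesting m ↔ ∃ t ≤ n, m ≤ shape P.cells t (n - t) 0 := by
  simp only [← incChain_iff P.isPlacement_cells]
  constructor
  · rintro ⟨i, j, h, hi, hj, hij⟩
    have h₁ := fun r => (h r).mem_Icc
    obtain ⟨t, ht, hit, hjt⟩ := exists_between_ends h hi hij
    refine ⟨t, ht, fun r => i r - 1, fun r => n - j r, fun r s hrs => ?_, fun r s hrs => ?_,
      fun r => ⟨(isArc_iff_cells (h₁ r).1 (h₁ r).2.2).1 (h r), ?_, ?_⟩⟩
    · have := hi hrs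
      have := h₁ r
      dsimp only
      omega
    · have := hj hrs
      have := h₁ r
      dsimp only
      omega
    · have := hit r
      have := h₁ r
      dsimp only
      omega
    · have := hjt r
      have := h₁ r
      dsimp only
      omega
  · rintro ⟨t, ht, p, q, hp, hq, hpq⟩
    refine ⟨fun r => p r + 1, fun r => n - q r, fun r => (hpq r).1, fun r s hrs => ?_,
      fun r s hrs => ?_, fun r s => ?_⟩
    · have := hp hrs
      dsimp only
      omega
    · have := hq hrs
      have := hpq s
      dsimp only
      omega
    · have := hpq r
      have := hpq s
      dsimp only
      omega

theorem hasCrossing_iff {m : ℕ} :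
    P.HasCrossing m ↔ ∃ t ≤ n, m ≤ conj (shape P.cells t (n - t)) 0 := by
  simp only [← decChain_iff P.isPlacement_cells]
  constructor
  · rintro ⟨i, j, h, hi, hj, hij⟩
    have h₁ := fun r => (h r).mem_Icc
    obtain ⟨t, ht, hit, hjt⟩ := exists_between_ends h hi hij
    refine ⟨t, ht, fun r => i r - 1, fun r => n - j r, fun r s hrs => ?_, fun r s hrs => ?_,
      fun r => ⟨(isArc_iff_cells (h₁ r).1 (h₁ r).2.2).1 (h r), ?_, ?_⟩⟩
    · have := hi hrs
      have := h₁ r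
      dsimp only
      omega
    · have := hj hrs
      have := h₁ s
      dsimp only
      omega
    · have := hit r
      have := h₁ r
      dsimp only
      omega
    · have := hjt r
      have := h₁ r
      dsimp only
      omega
  · rintro ⟨t, ht, p, q, hp, hq, hpq⟩
    refine ⟨fun r => p r + 1, fun r => n - q r, fun r => (hpq r).1, fun r s hrs => ?_,
      fun r s hrs => ?_, fun r s => ?_⟩
    · have := hp hrs
      dsimp only
      omega
    · have := hq hrs
      have := hpq r
      dsimp only
      omega
    · have := hpq r
      have := hpq s
      dsimp only
      omega

theorem isNonnesting_iff {k : ℕ} :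
    P.IsNonnesting k ↔ ∀ t ≤ n, shape P.cells t (n - t) 0 < k := by
  constructor
  · intro h t ht
    by_contra hk
    exact h.not_ge (P.isGreatest_ne.2 (hasNesting_iff.2 ⟨t, ht, not_lt.1 hk⟩))
  · intro h
    obtain ⟨t, ht, hle⟩ := hasNesting_iff.1 P.isGreatest_ne.1
    exact hle.trans_lt (h t ht)

theorem isNoncrossing_iff {k : ℕ} :
    P.IsNoncrossing k ↔ ∀ t ≤ n, conj (shape P.cells t (n - t)) 0 < k := by
  constructor
  · intro h t ht
    by_contra hk
    exact h.not_ge (P.isGreatest_cr.2 (hasCrossing_iff.2 ⟨t, ht, not_lt.1 hk⟩))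
  · intro h
    obtain ⟨t, ht, hle⟩ := hasCrossing_iff.1 P.isGreatest_cr.1
    exact hle.trans_lt (h t ht)

/-- Conjugating the shapes along the boundary of the staircase. -/
theorem exists_conj (P : SetPartition n) : ∃ Q : SetPartition n, ∀ x y, x + y ≤ n → n ≤ x + y + 1 →
    shape Q.cells x y = conj (shape P.cells x y) := by
  have hP := P.isPlacement_cells
  have hs := isShape_shape hP
  have hb : IsBoundary n fun x y => conj (shape P.cells x y) :=
    { isShape := fun x y => (hs x y).conj
      step_left := fun x y _ => (hs x y).step_conj (hs (x + 1) y) (step_shape_left hP x y)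
      step_right := fun x y _ => (hs x y).step_conj (hs x (y + 1)) (step_shape_right hP x y)
      zero_left := by simp
      zero_right := by simp }
  obtain ⟨X, hX, hX', h⟩ := hb.exists_placement
  obtain ⟨Q, rfl⟩ := exists_cells_eq hX hX'
  exact ⟨Q, h⟩

end SetPartition

/-- Conjugating boundary shapes exchanges the two bounds. It is injective because conjugation is an
involution and boundary shapes determine the arcs. One inequality suffices, since k and l are
arbitrary. -/
theorem NCN_le (k l n : ℕ) : NCN k l n ≤ NCN l k n := by
  classical
  choose Φ hΦ using SetPartition.exists_conj (n := n)
  have hs : ∀ P : SetPartition n, ∀ x y, IsShape (shape P.cells x y) :=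
    fun P => isShape_shape P.isPlacement_cells
  refine Finset.card_le_card_of_injOn Φ (fun P hP => ?_) fun P _ Q _ hPQ => ?_
  · simp only [Finset.coe_filter, Finset.mem_univ, true_and, Set.mem_ofPred_eq,
      SetPartition.isNoncrossing_iff, SetPartition.isNonnesting_iff] at hP ⊢
    refine ⟨fun t ht => ?_, fun t ht => ?_⟩
    · rw [hΦ P t (n - t) (by omega) (by omega), (hs P _ _).conj_conj]
      exact hP.2 t ht
    · rw [hΦ P t (n - t) (by omega) (by omega)]
      exact hP.1 t ht
  · refine SetPartition.cells_injective (eq_of_shape_eq P.isPlacement_cells Q.isPlacement_cells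
      P.cells_lt Q.cells_lt fun x y h₁ h₂ => ?_)
    rw [← (hs P x y).conj_conj, ← (hs Q x y).conj_conj, ← hΦ P x y h₁ h₂, ← hΦ Q x y h₁ h₂, hPQ]

theorem corollary1p2 (k l n : ℕ) : NCN k l n = NCN l k n :=
  (NCN_le k l n).antisymm (NCN_le l k n)
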